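/- **Colorful Steinitz Lemma.** Let $d, m, n$ be natural numbers, let $\|\cdot\|:\mathbb{R}^d\to\mathbb{R}$ be an arbitrary norm, and let $\mathcal{U}=\{x\in\mathbb{R}^d : \|x\|\le 1\}$ be its unit ball. Let $(u_1^i)_{i=1}^m,\ldots,(u_n^i)_{i=1}^m$ be $n$ sequences of length $m$ in $\mathcal{U}$ whose union is a zero-sum sequence, that is, $\sum_{j=1}^n\sum_{i=1}^m u_j^i=0$. Then there exist permutations $\pi_1,\ldots,\pi_n$ of $\{1,\ldots,m\}$ such that $$\left\|\sum_{i=1}^k\sum_{j=1}^n u_j^{\pi_j(i)}\right\|\le\min\{nd,\,40d^5\}$$ for each $k\in\{1,\ldots,m\}$. -/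

import Mathlib

/-!
Let `D` be the dimension. A point of the cube `[0, 1]^ι` can be moved within a fiber of a linear map
to an extreme point, where the columns of the map at the non-integral coordinates are linearly
independent, so that few coordinates are non-integral.

For a single sequence with mean `e`, this allows one to remove vectors one at a time while keeping
weights in `[0, 1]` of mass `k - D` on the `k` remaining vectors, with weighted sum `(k - D) e`. The
defects `1 - weight` add up to `D`, so in the resulting order the partial sums stay within `D` of
multiples of `e`. These multiples depend only on the number of summands, so when the sequences of
all `n` colours are ordered in this way the multiples cancel, which gives the bound `n D`.

For a bound independent of `n`, the cube argument is applied with one extra equation per colour,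
fixing how many elements of that colour are selected. A colour with a non-integral coordinate has at
least two of them, so if `f` coordinates are non-integral then `f ≤ D + f / 2`, that is `f ≤ 2 D`.
Rounding them splits each colour class into two halves of prescribed sizes, with an error of `2 D`
in the sum. A total sum of size at most `6 D` is thus split into two sums of size at most
`(2 / 3) 6 D + 2 D = 6 D`, and repeated halving ends with transversals of size at most `6 D`.
Ordering the transversals as a single sequence gives `6 D ^ 2`, which is at most `40 D ^ 5`.
-/

section BasicPoints

open Finset Filter Topology

variable {ι W : Type*}

open Classical in
/-- The coordinates at which a point of the cube `[0, 1]^ι` is not integral. -/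
noncomputable def fractionalCoords [Fintype ι] (y : ι → ℝ) : Finset ι :=
  {i | y i ∈ Set.Ioo 0 1}

theorem mem_fractionalCoords [Fintype ι] {y : ι → ℝ} {i : ι} :
    i ∈ fractionalCoords y ↔ y i ∈ Set.Ioo 0 1 := by
  simp [fractionalCoords]

theorem eq_zero_or_eq_one_of_notMem_fractionalCoords [Fintype ι] {y : ι → ℝ}
    (hy : y ∈ Set.Icc 0 1) {i : ι} (hi : i ∉ fractionalCoords y) : y i = 0 ∨ y i = 1 := by
  by_contra! h
  exact hi (mem_fractionalCoords.mpr ⟨(hy.1 i).lt_of_ne' h.1, (hy.2 i).lt_of_ne h.2⟩)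

theorem eventually_add_smul_mem_Icc [Finite ι] {b y z : ι → ℝ} (hy : y ∈ Set.Icc 0 b)
    (hz : ∀ i, z i ≠ 0 → y i ∈ Set.Ioo 0 (b i)) :
    ∀ᶠ t : ℝ in 𝓝 0, y + t • z ∈ Set.Icc 0 b := by
  have hcoord : ∀ i, ∀ᶠ t : ℝ in 𝓝 0, y i + t * z i ∈ Set.Icc 0 (b i) := by
    intro i
    rcases eq_or_ne (z i) 0 with hzi | hzi
    · simpa [hzi] using And.intro (hy.1 i) (hy.2 i)
    · have hlim : Tendsto (fun t : ℝ => y i + t * z i) (𝓝 0) (𝓝 (y i)) := by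
        simpa using (by fun_prop : Continuous fun t : ℝ => y i + t * z i).tendsto 0
      exact hlim.eventually (Icc_mem_nhds (hz i hzi).1 (hz i hzi).2)
  filter_upwards [eventually_all.mpr hcoord] with t ht
  exact ⟨fun i => (ht i).1, fun i => (ht i).2⟩

theorem eq_zero_of_mem_extremePoints_Icc_inter_fiber [Finite ι] [AddCommGroup W] [Module ℝ W]
    {L : (ι → ℝ) →ₗ[ℝ] W} {b y z : ι → ℝ} {e : W}
    (hy : y ∈ (Set.Icc 0 b ∩ L ⁻¹' {e}).extremePoints ℝ) (hLz : L z = 0)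
    (hz : ∀ i, z i ≠ 0 → y i ∈ Set.Ioo 0 (b i)) : z = 0 := by
  obtain ⟨⟨hyIcc, rfl⟩, hext⟩ := hy
  have hneg : ∀ᶠ t : ℝ in 𝓝 0, y - t • z ∈ Set.Icc 0 b := by
    simpa [sub_eq_add_neg] using
      eventually_add_smul_mem_Icc hyIcc (z := -z) (fun i hi => hz i (by simpa using hi))
  obtain ⟨t, ⟨htadd, htsub⟩, ht⟩ :=
    (((eventually_add_smul_mem_Icc hyIcc hz).and hneg).filter_mono nhdsWithin_le_nhds
      |>.and (self_mem_nhdsWithin : Set.Ioi (0 : ℝ) ∈ 𝓝[>] 0)).exists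
  have heq : y - t • z = y :=
    hext ⟨htsub, by simp [hLz]⟩ ⟨htadd, by simp [hLz]⟩ (mem_openSegment_sub_add y (t • z))
  exact (smul_eq_zero.mp (sub_eq_self.mp heq)).resolve_left (ne_of_gt ht)

theorem isCompact_Icc_inter_fiber [Finite ι] [AddCommGroup W] [Module ℝ W]
    (L : (ι → ℝ) →ₗ[ℝ] W) (b x : ι → ℝ) : IsCompact (Set.Icc 0 b ∩ L ⁻¹' {L x}) := by
  refine isCompact_Icc.inter_right ?_
  have hfiber : L ⁻¹' {L x} = (fun y => y - x) ⁻¹' (LinearMap.ker L : Set (ι → ℝ)) := by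
    ext y
    simp [sub_eq_zero]
  rw [hfiber]
  exact (Submodule.closed_of_finiteDimensional _).preimage (by fun_prop)

theorem exists_mem_Icc_linearIndepOn_fractionalCoords [Fintype ι] [AddCommGroup W]
    [Module ℝ W] (w : ι → W) {x : ι → ℝ} (hx : x ∈ Set.Icc 0 1) :
    ∃ y ∈ Set.Icc (0 : ι → ℝ) 1, ∑ i, y i • w i = ∑ i, x i • w i ∧
      Function.support y ⊆ Function.support x ∧ LinearIndepOn ℝ w (fractionalCoords y) := by
  classical
  set L := Fintype.linearCombination ℝ w with hL
  set b : ι → ℝ := (Function.support x).indicator 1 with hb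
  have hxb : x ∈ Set.Icc 0 b := ⟨hx.1, fun i => by
    by_cases hi : x i = 0
    · simp [hb, hi]
    · simpa [hb, hi] using hx.2 i⟩
  obtain ⟨y, hy⟩ := (isCompact_Icc_inter_fiber L b x).extremePoints_nonempty ⟨x, hxb, rfl⟩
  have hyb : y ∈ Set.Icc 0 b := hy.1.1
  have hsupp : Function.support y ⊆ Function.support x := fun i hyi => by
    by_contra hxi
    exact hyi (le_antisymm (by simpa [hb, hxi] using hyb.2 i) (hyb.1 i))
  refine ⟨y, ⟨hyb.1, fun i => (hyb.2 i).trans (Set.indicator_le_self' (by simp) i)⟩, ?_, hsupp,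
    linearIndepOn_finset_iff.mpr fun g hg => ?_⟩
  · simpa [hL, Fintype.linearCombination_apply] using hy.1.2
  set z : ι → ℝ := (fractionalCoords y : Set ι).indicator g with hz
  have hLz : L z = 0 := by
    simpa [hL, hz, Fintype.linearCombination_apply, Set.indicator_apply, ite_smul] using hg
  have hz0 : z = 0 := eq_zero_of_mem_extremePoints_Icc_inter_fiber hy hLz fun i hi => by
    have hyi := mem_fractionalCoords.mp (mem_coe.mp (Set.mem_of_indicator_ne_zero hi))
    have hxi : i ∈ Function.support x := hsupp hyi.1.ne'
    simpa [hb, Set.indicator_of_mem hxi] using hyi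
  intro i hi
  simpa [hz, hi] using congrFun hz0 i

end BasicPoints

section Steinitz

open Finset

-- The removed elements are listed from the last to the first.
theorem exists_list_forall_prefix {α : Type*} [DecidableEq α] {Q : Finset α → Prop}
    (hstep : ∀ A, A.Nonempty → Q A → ∃ a ∈ A, Q (A.erase a)) (A : Finset α) (hA : Q A) :
    ∃ l : List α, l.Nodup ∧ l.toFinset = A ∧ ∀ l', l' <+: l → Q l'.toFinset := by
  induction A using Finset.strongInduction with
  | H A ih =>
  rcases A.eq_empty_or_nonempty with rfl | hne
  · exact ⟨[], by simpa using hA⟩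
  obtain ⟨a, ha, hQa⟩ := hstep A hne hA
  obtain ⟨l, hl, hlA, hlQ⟩ := ih _ (erase_ssubset ha) hQa
  have hal : a ∉ l := fun h => notMem_erase a A (hlA ▸ List.mem_toFinset.mpr h)
  have hlaA : (l ++ [a]).toFinset = A := by
    simp [List.toFinset_append, hlA, insert_erase ha]
  refine ⟨l ++ [a], by simpa using hl.concat hal, hlaA, fun l' hl' => ?_⟩
  rcases List.prefix_concat_iff.mp hl' with rfl | hl'
  · rwa [hlaA]
  · exact hlQ l' hl'

theorem exists_perm_forall_map_Iic {m : ℕ} {Q : Finset (Fin m) → Prop} (huniv : Q univ)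
    (hstep : ∀ A, A.Nonempty → Q A → ∃ a ∈ A, Q (A.erase a)) :
    ∃ π : Equiv.Perm (Fin m), ∀ k, Q ((Iic k).map π.toEmbedding) := by
  obtain ⟨l, hl, hluniv, hlQ⟩ := exists_list_forall_prefix hstep univ huniv
  have hlen : l.length = m := by simpa [hluniv] using (List.toFinset_card_of_nodup hl).symm
  let π : Equiv.Perm (Fin m) := (finCongr hlen.symm).trans
    (hl.getEquivOfForallMemList l fun a => List.mem_toFinset.mp (hluniv ▸ mem_univ a))
  refine ⟨π, fun k => ?_⟩
  have hmap : (Iic k).map π.toEmbedding = (l.take (k + 1)).toFinset := by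
    ext a
    simp only [mem_map, mem_Iic, List.mem_toFinset, List.mem_take_iff_getElem]
    constructor
    · rintro ⟨i, hi, rfl⟩
      exact ⟨i, by grind, rfl⟩
    · rintro ⟨i, hi, rfl⟩
      exact ⟨⟨i, by grind⟩, by grind, rfl⟩
  rw [hmap]
  exact hlQ _ (List.take_prefix _ _)

theorem exists_eq_zero_of_sum_add_card_fractionalCoords_le {ι : Type*} [Fintype ι] {y : ι → ℝ}
    (hy : y ∈ Set.Icc 0 1) {s : Finset ι} (hlt : ∑ i ∈ s, y i < #s)
    (hle : ∑ i ∈ s, y i + #(fractionalCoords y) ≤ #s) : ∃ i ∈ s, y i = 0 := by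
  classical
  by_contra! hne
  have hone : ∀ i ∈ s, 1 ≤ y i + if i ∈ fractionalCoords y then 1 else 0 := by
    intro i hi
    split_ifs with hfrac
    · linarith [(mem_fractionalCoords.mp hfrac).1]
    · simp [(eq_zero_or_eq_one_of_notMem_fractionalCoords hy hfrac).resolve_left (hne i hi)]
  obtain ⟨i, hi, hyi⟩ : ∃ i ∈ s, y i < 1 := exists_lt_of_sum_lt (by simpa using hlt)
  have hpos : 0 < y i := (hy.1 i).lt_of_ne' (hne i hi)
  have hfrac : i ∈ fractionalCoords y := mem_fractionalCoords.mpr ⟨hpos, hyi⟩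
  have hsum := sum_lt_sum hone ⟨i, hi, by simpa [hfrac] using hpos⟩
  have hcard : (#(s ∩ fractionalCoords y) : ℝ) ≤ #(fractionalCoords y) := by
    exact_mod_cast card_le_card inter_subset_right
  simp only [sum_const, nsmul_eq_mul, mul_one, sum_add_distrib, sum_ite_mem] at hsum
  linarith

variable {ι E : Type*} [Fintype ι] [AddCommGroup E] [Module ℝ E]

/-- Grinberg–Sevastyanov weights: coefficients in `[0, 1]` on the elements of `A`, of total mass
`#A - finrank ℝ E`, whose weighted sum of `v` is that multiple of the drift `e`. They keep the sum
of `v` over `A` close to the ray of `e`. The mass is a truncated difference, hence `0` when `A` has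
at most `finrank ℝ E` elements. -/
structure IsSteinitzWeight (v : ι → E) (e : E) (A : Finset ι) (l : ι → ℝ) : Prop where
  mem_Icc : l ∈ Set.Icc 0 1
  eq_zero : ∀ i ∉ A, l i = 0
  sum_eq : ∑ i, l i = (#A - Module.finrank ℝ E : ℕ)
  sum_smul_eq : ∑ i, l i • v i = ((#A - Module.finrank ℝ E : ℕ) : ℝ) • e

theorem IsSteinitzWeight.seminorm_sum_sub_le {v : ι → E} {e : E} {A : Finset ι} {l : ι → ℝ}
    (hl : IsSteinitzWeight v e A l) (p : Seminorm ℝ E) {M : ℝ} (hM : 0 ≤ M)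
    (hv : ∀ i, p (v i) ≤ M) :
    p (∑ i ∈ A, v i - ((#A - Module.finrank ℝ E : ℕ) : ℝ) • e) ≤ Module.finrank ℝ E * M := by
  have hmass : ∑ i ∈ A, l i = (#A - Module.finrank ℝ E : ℕ) :=
    hl.sum_eq ▸ sum_subset (subset_univ A) fun i _ hi => hl.eq_zero i hi
  have hdrift : ∑ i ∈ A, l i • v i = ((#A - Module.finrank ℝ E : ℕ) : ℝ) • e :=
    hl.sum_smul_eq ▸ sum_subset (subset_univ A) fun i _ hi => by simp [hl.eq_zero i hi]
  have hterm : ∀ i, p (v i - l i • v i) ≤ (1 - l i) * M := fun i => by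
    have hl1 : 0 ≤ 1 - l i := sub_nonneg.mpr (hl.mem_Icc.2 i)
    calc p (v i - l i • v i) = p ((1 - l i) • v i) := by rw [sub_smul, one_smul]
      _ = (1 - l i) * p (v i) := by rw [map_smul_eq_mul, Real.norm_of_nonneg hl1]
      _ ≤ (1 - l i) * M := by gcongr; exact hv i
  have hcard : (#A : ℝ) ≤ (#A - Module.finrank ℝ E : ℕ) + Module.finrank ℝ E := by
    exact_mod_cast le_tsub_add
  calc p (∑ i ∈ A, v i - ((#A - Module.finrank ℝ E : ℕ) : ℝ) • e)
      = p (∑ i ∈ A, (v i - l i • v i)) := by rw [sum_sub_distrib, hdrift]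
    _ ≤ ∑ i ∈ A, p (v i - l i • v i) :=
        le_sum_of_subadditive p (map_zero p).le (map_add_le_add p) _ _
    _ ≤ ∑ i ∈ A, (1 - l i) * M := sum_le_sum fun i _ => hterm i
    _ = (#A - (#A - Module.finrank ℝ E : ℕ)) * M := by simp [← sum_mul, hmass]
    _ ≤ Module.finrank ℝ E * M := by gcongr; linarith

theorem isSteinitzWeight_univ {v : ι → E} {e : E} (he : ∑ i, v i = (Fintype.card ι : ℝ) • e) :
    IsSteinitzWeight v e univ
      (fun _ => ((Fintype.card ι - Module.finrank ℝ E : ℕ) : ℝ) / Fintype.card ι) := by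
  have hmul : (Fintype.card ι : ℝ) * (((Fintype.card ι - Module.finrank ℝ E : ℕ) : ℝ) /
      Fintype.card ι) = (Fintype.card ι - Module.finrank ℝ E : ℕ) :=
    mul_div_cancel_of_imp' fun h => by simp [Nat.cast_eq_zero.mp h]
  refine ⟨⟨fun _ => ?_, fun _ => ?_⟩, by simp, by simp [hmul], ?_⟩
  · exact div_nonneg (Nat.cast_nonneg _) (Nat.cast_nonneg _)
  · exact div_le_one_of_le₀ (Nat.cast_le.mpr (Nat.sub_le _ _)) (by positivity)
  · rw [← smul_sum, he, smul_smul, mul_comm, hmul, card_univ]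

theorem IsSteinitzWeight.exists_smul_rounding [FiniteDimensional ℝ E] {v : ι → E} {e : E}
    {A : Finset ι} {l : ι → ℝ} (hl : IsSteinitzWeight v e A l) {r : ℕ}
    (hr : #A = Module.finrank ℝ E + r + 1) :
    ∃ y ∈ Set.Icc (0 : ι → ℝ) 1, (∀ i ∉ A, y i = 0) ∧ ∑ i, y i = r ∧
      ∑ i, y i • v i = (r : ℝ) • e ∧ #(fractionalCoords y) ≤ Module.finrank ℝ E + 1 := by
  -- Scaling `l` by `t` lowers its mass from `r + 1` to `r`.
  set t : ℝ := r / (r + 1) with ht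
  have hmass : #A - Module.finrank ℝ E = r + 1 := by omega
  have ht0 : 0 ≤ t := by positivity
  have ht1 : t ≤ 1 := div_le_one_of_le₀ (by linarith) (by positivity)
  have htr : t * (r + 1 : ℕ) = r := by rw [ht]; push_cast; field_simp
  have htl : t • l ∈ Set.Icc (0 : ι → ℝ) 1 :=
    ⟨fun i => mul_nonneg ht0 (hl.mem_Icc.1 i),
      fun i => mul_le_one₀ ht1 (hl.mem_Icc.1 i) (hl.mem_Icc.2 i)⟩
  obtain ⟨y, hy, hyw, hysupp, hyind⟩ :=
    exists_mem_Icc_linearIndepOn_fractionalCoords (fun i => (v i, (1 : ℝ))) htl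
  have hfst := congrArg Prod.fst hyw
  have hsnd := congrArg Prod.snd hyw
  simp only [Prod.fst_sum, Prod.snd_sum, Prod.smul_mk, Pi.smul_apply, smul_eq_mul, mul_one,
    mul_smul, ← smul_sum, ← mul_sum, hl.sum_eq, hl.sum_smul_eq, hmass] at hfst hsnd
  refine ⟨y, hy, fun i hi => ?_, by rw [hsnd, htr], by rw [hfst, smul_smul, htr], ?_⟩
  · by_contra hyi
    exact hysupp hyi (by simp [hl.eq_zero i hi])
  · simpa [Module.finrank_prod] using hyind.fintype_card_le_finrank

theorem IsSteinitzWeight.exists_erase [DecidableEq ι] [FiniteDimensional ℝ E] {v : ι → E} {e : E}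
    {A : Finset ι} (hne : A.Nonempty) {l : ι → ℝ} (hl : IsSteinitzWeight v e A l) :
    ∃ a ∈ A, ∃ l', IsSteinitzWeight v e (A.erase a) l' := by
  rcases le_or_gt #A (Module.finrank ℝ E) with hle | hlt
  · obtain ⟨a, ha⟩ := hne
    have hmass : #(A.erase a) - Module.finrank ℝ E = 0 := by grind
    exact ⟨a, ha, 0, by simp, by simp, by simp [hmass], by simp [hmass]⟩
  obtain ⟨r, hr⟩ : ∃ r, #A = Module.finrank ℝ E + r + 1 :=
    ⟨#A - Module.finrank ℝ E - 1, by omega⟩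
  obtain ⟨y, hy, hyA, hysum, hyv, hfrac⟩ := hl.exists_smul_rounding hr
  have hysumA : ∑ i ∈ A, y i = r :=
    hysum ▸ sum_subset (subset_univ A) fun i _ hi => hyA i hi
  have hfrac' : (#(fractionalCoords y) : ℝ) ≤ Module.finrank ℝ E + 1 := by exact_mod_cast hfrac
  have hr' : (#A : ℝ) = Module.finrank ℝ E + r + 1 := by exact_mod_cast hr
  obtain ⟨a, ha, hya⟩ : ∃ a ∈ A, y a = 0 :=
    exists_eq_zero_of_sum_add_card_fractionalCoords_le hy (by rw [hysumA, hr']; linarith)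
      (by rw [hysumA, hr']; linarith)
  have hmass : #(A.erase a) - Module.finrank ℝ E = r := by grind
  refine ⟨a, ha, y, hy, fun i hi => ?_, by rw [hmass, hysum], by rw [hmass, hyv]⟩
  grind

theorem exists_perm_seminorm_sum_sub_smul_le [FiniteDimensional ℝ E] (p : Seminorm ℝ E) {m : ℕ}
    {M : ℝ} {v : Fin m → E} (hv : ∀ i, p (v i) ≤ M) :
    ∃ π : Equiv.Perm (Fin m), ∀ k : Fin m,
      p (∑ i ∈ Iic k, v (π i) -
        ((k + 1 - Module.finrank ℝ E : ℕ) : ℝ) • (m : ℝ)⁻¹ • ∑ i, v i) ≤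
          Module.finrank ℝ E * M := by
  have hmean : ∑ i, v i = (Fintype.card (Fin m) : ℝ) • (m : ℝ)⁻¹ • ∑ i, v i := by
    rcases eq_or_ne m 0 with rfl | hm
    · simp
    · rw [Fintype.card_fin, smul_inv_smul₀ (by exact_mod_cast hm)]
  obtain ⟨π, hπ⟩ := exists_perm_forall_map_Iic
    (Q := fun A => ∃ l, IsSteinitzWeight v ((m : ℝ)⁻¹ • ∑ i, v i) A l)
    ⟨_, isSteinitzWeight_univ hmean⟩ fun A hA ⟨l, hl⟩ => hl.exists_erase hA
  refine ⟨π, fun k => ?_⟩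
  obtain ⟨l, hl⟩ := hπ k
  simpa using hl.seminorm_sum_sub_le p ((apply_nonneg p _).trans (hv k)) hv

end Steinitz

section Rounding

open Finset

theorem card_le_finrank_add_card_image {ι κ E : Type*} [DecidableEq κ] [AddCommGroup E] [Module ℝ E]
    [FiniteDimensional ℝ E] {c : ι → κ} {u : ι → E} {s : Finset ι}
    (h : LinearIndepOn ℝ (fun i => (u i, Finsupp.single (c i) (1 : ℝ))) (s : Set ι)) :
    #s ≤ Module.finrank ℝ E + #(s.image c) := by
  -- Only the colours occurring in `s` contribute to the rank, not all of `κ`.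
  let v : s → E × (s.image c →₀ ℝ) := fun i =>
    (u i, Finsupp.single ⟨c i, mem_image_of_mem c i.2⟩ 1)
  let T : E × (s.image c →₀ ℝ) →ₗ[ℝ] E × (κ →₀ ℝ) :=
    LinearMap.id.prodMap (Finsupp.lmapDomain ℝ ℝ Subtype.val)
  have hTv : T ∘ v = fun i : s => (u i, Finsupp.single (c i) 1) := by
    ext i : 1
    simp [T, v]
  have hv : LinearIndependent ℝ v := .of_comp T (hTv ▸ h)
  simpa using hv.fintype_card_le_finrank

theorem exists_subset_card_eq_of_sum_eq {ι : Type*} {y : ι → ℝ} (hy : y ∈ Set.Icc 0 1)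
    {s : Finset ι} {b : ℕ} (hb : ∑ i ∈ s, y i = b) :
    ∃ B ⊆ s, #B = b ∧ (∀ i ∈ s, y i = 1 → i ∈ B) ∧ ∀ i ∈ B, y i ≠ 0 := by
  classical
  have hones : #{i ∈ s | y i = 1} ≤ b := by
    rify
    rw [← hb, card_filter, Nat.cast_sum]
    refine sum_le_sum fun i _ => ?_
    split_ifs with h
    · simp [h]
    · simpa using hy.1 i
  have hpos : b ≤ #{i ∈ s | y i ≠ 0} := by
    rify
    rw [← hb, card_filter, Nat.cast_sum]
    refine sum_le_sum fun i _ => ?_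
    split_ifs with h
    · simpa using hy.2 i
    · simp [not_not.mp h]
  obtain ⟨B, hBones, hBpos, hBcard⟩ := exists_subsuperset_card_eq
    (monotone_filter_right s fun i _ (h : y i = 1) => by simp [h]) hones hpos
  exact ⟨B, hBpos.trans (filter_subset _ _), hBcard,
    fun i hi h => hBones (mem_filter.mpr ⟨hi, h⟩), fun i hi => (mem_filter.mp (hBpos hi)).2⟩

variable {ι : Type*} [Fintype ι]

/-- A set `B` rounds `y : ι → ℝ` if passing from `y` to the indicator function of `B` changes only
coordinates that are not already `0` or `1`. -/
structure IsRounding (y : ι → ℝ) (B : Finset ι) : Prop where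
  mem_of_eq_one : ∀ i, y i = 1 → i ∈ B
  ne_zero_of_mem : ∀ i ∈ B, y i ≠ 0

theorem IsRounding.seminorm_sum_sub_le {E : Type*} [AddCommGroup E] [Module ℝ E] {y : ι → ℝ}
    {B : Finset ι} (hB : IsRounding y B) (hy : y ∈ Set.Icc 0 1) (p : Seminorm ℝ E) {u : ι → E}
    (hu : ∀ i, p (u i) ≤ 1) :
    p (∑ i ∈ B, u i - ∑ i, y i • u i) ≤ #(fractionalCoords y) := by
  classical
  set ε : ι → ℝ := fun i => (if i ∈ B then 1 else 0) - y i with hε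
  have hε_abs : ∀ i, |ε i| ≤ 1 := fun i => by
    have h0 : 0 ≤ y i := hy.1 i
    have h1 : y i ≤ 1 := hy.2 i
    simp only [hε, abs_le]
    split_ifs <;> constructor <;> linarith
  have hε_zero : ∀ i ∉ fractionalCoords y, ε i = 0 := fun i hi => by
    rcases eq_zero_or_eq_one_of_notMem_fractionalCoords hy hi with h | h
    · simp [hε, h, show i ∉ B from fun hiB => hB.ne_zero_of_mem i hiB h]
    · simp [hε, h, hB.mem_of_eq_one i h]
  calc p (∑ i ∈ B, u i - ∑ i, y i • u i)
      = p (∑ i, ε i • u i) := by simp [hε, sub_smul, ite_smul]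
    _ = p (∑ i ∈ fractionalCoords y, ε i • u i) := by
        congr 1
        exact (sum_subset (subset_univ _) fun i _ hi => by rw [hε_zero i hi, zero_smul]).symm
    _ ≤ ∑ i ∈ fractionalCoords y, p (ε i • u i) :=
        le_sum_of_subadditive p (map_zero p).le (map_add_le_add p) _ _
    _ ≤ ∑ i ∈ fractionalCoords y, 1 := sum_le_sum fun i _ => by
        rw [map_smul_eq_mul, Real.norm_eq_abs]
        exact mul_le_one₀ (hε_abs i) (apply_nonneg p _) (hu i)
    _ = #(fractionalCoords y) := by simp

theorem card_inter_fractionalCoords_ne_one [DecidableEq ι] {y : ι → ℝ} (hy : y ∈ Set.Icc 0 1)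
    {s : Finset ι} {b : ℕ} (hb : ∑ i ∈ s, y i = b) : #(s ∩ fractionalCoords y) ≠ 1 := by
  intro hone
  obtain ⟨i, hi⟩ := card_eq_one.mp hone
  have hints : ∑ k ∈ s \ fractionalCoords y, y k = #{k ∈ s \ fractionalCoords y | y k = 1} := by
    rw [card_filter, Nat.cast_sum]
    refine sum_congr rfl fun k hk => ?_
    rcases eq_zero_or_eq_one_of_notMem_fractionalCoords hy (mem_sdiff.mp hk).2 with h | h <;>
      simp [h]
  have hsplit := sum_inter_add_sum_sdiff s (fractionalCoords y) y
  rw [hi, sum_singleton, hints, hb] at hsplit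
  obtain ⟨hlo, hhi⟩ : y i ∈ Set.Ioo 0 1 :=
    mem_fractionalCoords.mp (mem_inter.mp (hi ▸ mem_singleton_self i)).2
  have hlt : #{k ∈ s \ fractionalCoords y | y k = 1} < b := by rify; linarith
  have hlt' : b < #{k ∈ s \ fractionalCoords y | y k = 1} + 1 := by rify; linarith
  omega

variable {κ : Type*} [DecidableEq κ] {c : ι → κ}

theorem two_mul_card_image_fractionalCoords_le {y : ι → ℝ} (hy : y ∈ Set.Icc 0 1) {b : κ → ℕ}
    (hb : ∀ j, ∑ i with c i = j, y i = b j) :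
    2 * #((fractionalCoords y).image c) ≤ #(fractionalCoords y) := by
  classical
  refine mul_card_image_le_card _ _ fun j hj => ?_
  obtain ⟨i, hi, hij⟩ := mem_image.mp hj
  have hinter : ({i | c i = j} : Finset ι) ∩ fractionalCoords y =
      {i ∈ fractionalCoords y | c i = j} := by
    ext
    simp [and_comm]
  have hpos : 0 < #{i ∈ fractionalCoords y | c i = j} :=
    card_pos.mpr ⟨i, mem_filter.mpr ⟨hi, hij⟩⟩
  have hne := hinter ▸ card_inter_fractionalCoords_ne_one hy (hb j)
  omega

theorem exists_isRounding_card_fiber_eq {y : ι → ℝ} (hy : y ∈ Set.Icc 0 1) {b : κ → ℕ}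
    (hb : ∀ j, ∑ i with c i = j, y i = b j) :
    ∃ B, IsRounding y B ∧ ∀ j, #{i ∈ B | c i = j} = b j := by
  classical
  choose B hBsub hBcard hBone hBzero using fun j => exists_subset_card_eq_of_sum_eq hy (hb j)
  refine ⟨({i | i ∈ B (c i)} : Finset ι), ⟨fun i hi => ?_, fun i hi => ?_⟩, fun j => ?_⟩
  · simpa using hBone (c i) i (by simp) hi
  · exact hBzero (c i) i (by simpa using hi)
  · rw [← hBcard j]
    congr 1
    ext i
    have hcolor : i ∈ B j → c i = j := fun hi => by simpa using hBsub j hi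
    simp only [mem_filter, mem_univ, true_and]
    exact ⟨fun ⟨hi, hij⟩ => hij ▸ hi, fun hi => ⟨(hcolor hi).symm ▸ hi, hcolor hi⟩⟩

theorem exists_card_fiber_eq_seminorm_sum_sub_le {E : Type*} [AddCommGroup E] [Module ℝ E]
    [FiniteDimensional ℝ E] (p : Seminorm ℝ E) {u : ι → E} (hu : ∀ i, p (u i) ≤ 1) {x : ι → ℝ}
    (hx : x ∈ Set.Icc 0 1) {b : κ → ℕ} (hb : ∀ j, ∑ i with c i = j, x i = b j) :
    ∃ B : Finset ι, (∀ i ∈ B, x i ≠ 0) ∧ (∀ j, #{i ∈ B | c i = j} = b j) ∧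
      p (∑ i ∈ B, u i - ∑ i, x i • u i) ≤ 2 * Module.finrank ℝ E := by
  obtain ⟨y, hy, hyw, hysupp, hyind⟩ := exists_mem_Icc_linearIndepOn_fractionalCoords
    (fun i => (u i, Finsupp.single (c i) (1 : ℝ))) hx
  have hyu : ∑ i, y i • u i = ∑ i, x i • u i := by
    simpa [Prod.fst_sum] using congrArg Prod.fst hyw
  have hyb : ∀ j, ∑ i with c i = j, y i = b j := fun j => by
    rw [← hb j]
    simpa [Prod.snd_sum, Finsupp.finsetSum_apply, Finsupp.single_apply, sum_filter] using
      DFunLike.congr_fun (congrArg Prod.snd hyw) j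
  obtain ⟨B, hB, hBcard⟩ := exists_isRounding_card_fiber_eq hy hyb
  have hfrac : #(fractionalCoords y) ≤ 2 * Module.finrank ℝ E := by
    have hrank := card_le_finrank_add_card_image hyind
    have htwo := two_mul_card_image_fractionalCoords_le hy hyb
    omega
  refine ⟨B, fun i hi => hysupp (hB.ne_zero_of_mem i hi), hBcard, ?_⟩
  calc p (∑ i ∈ B, u i - ∑ i, x i • u i) = p (∑ i ∈ B, u i - ∑ i, y i • u i) := by rw [hyu]
    _ ≤ #(fractionalCoords y) := hB.seminorm_sum_sub_le hy p hu
    _ ≤ 2 * Module.finrank ℝ E := by exact_mod_cast hfrac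

end Rounding

section Transversals

open Finset

variable {ι κ E : Type*} [AddCommGroup E]

theorem seminorm_le_of_seminorm_sub_smul_le [Module ℝ E] {p : Seminorm ℝ E} {C t : ℝ} {s w : E}
    (ht : 0 ≤ t) (hs : p s ≤ C) (hw : p (w - t • s) ≤ (1 - t) * C) : p w ≤ C :=
  calc p w = p ((w - t • s) + t • s) := by rw [sub_add_cancel]
    _ ≤ p (w - t • s) + p (t • s) := map_add_le_add p _ _
    _ = p (w - t • s) + t * p s := by rw [map_smul_eq_mul, Real.norm_of_nonneg ht]
    _ ≤ (1 - t) * C + t * C := by gcongr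
    _ = C := by ring

theorem exists_subset_card_fiber_eq_seminorm_sum_sub_le [Finite ι] [DecidableEq κ] [Module ℝ E]
    [FiniteDimensional ℝ E] (p : Seminorm ℝ E) {u : ι → E} (hu : ∀ i, p (u i) ≤ 1) {c : ι → κ}
    {a b : ℕ} (hba : b ≤ a) {A : Finset ι} (hA : ∀ j, #{i ∈ A | c i = j} = a) :
    ∃ B ⊆ A, (∀ j, #{i ∈ B | c i = j} = b) ∧
      p (∑ i ∈ B, u i - (b / a : ℝ) • ∑ i ∈ A, u i) ≤ 2 * Module.finrank ℝ E := by
  classical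
  cases nonempty_fintype ι
  set x : ι → ℝ := fun i => if i ∈ A then b / a else 0 with hx
  have hba' : (b / a : ℝ) ≤ 1 := div_le_one_of_le₀ (by exact_mod_cast hba) (by positivity)
  have hxcube : x ∈ Set.Icc 0 1 := by
    constructor <;> intro i <;> by_cases hi : i ∈ A <;>
      simp only [hx, hi, if_true, if_false, Pi.zero_apply, Pi.one_apply, le_refl, zero_le_one,
        hba']
    positivity
  have hab : (a : ℝ) * (b / a) = b := mul_div_cancel_of_imp' fun h => by
    rw [Nat.cast_eq_zero] at h ⊢
    omega
  have hxb : ∀ j, ∑ i with c i = j, x i = b := fun j => by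
    have hinter : ({i | c i = j} : Finset ι) ∩ A = {i ∈ A | c i = j} := by
      ext
      simp [and_comm]
    rw [hx, sum_ite_mem, hinter, sum_const, hA, nsmul_eq_mul, hab]
  obtain ⟨B, hBx, hB, hBp⟩ := exists_card_fiber_eq_seminorm_sum_sub_le p hu hxcube hxb
  refine ⟨B, fun i hi => ?_, hB, ?_⟩
  · by_contra hiA
    exact hBx i hi (by simp [hx, hiA])
  · simpa [hx, ite_smul, ← smul_sum] using hBp

theorem exists_split_seminorm_sum_le [Finite ι] [DecidableEq ι] [DecidableEq κ] [Module ℝ E]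
    [FiniteDimensional ℝ E] (p : Seminorm ℝ E) {u : ι → E} (hu : ∀ i, p (u i) ≤ 1) {c : ι → κ}
    {b b' : ℕ} (hb : 0 < b) (hbb' : b ≤ 2 * b') (hb'b : b' ≤ 2 * b) {A : Finset ι}
    (hA : ∀ j, #{i ∈ A | c i = j} = b + b') (hsum : p (∑ i ∈ A, u i) ≤ 6 * Module.finrank ℝ E) :
    ∃ B ⊆ A, ((∀ j, #{i ∈ B | c i = j} = b) ∧ p (∑ i ∈ B, u i) ≤ 6 * Module.finrank ℝ E) ∧
      (∀ j, #{i ∈ A \ B | c i = j} = b') ∧ p (∑ i ∈ A \ B, u i) ≤ 6 * Module.finrank ℝ E := by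
  obtain ⟨B, hBA, hB, hBp⟩ :=
    exists_subset_card_fiber_eq_seminorm_sum_sub_le p hu (Nat.le_add_right b b') hA
  set t : ℝ := b / (b + b' : ℕ) with ht
  have hpos : (0 : ℝ) < (b + b' : ℕ) := by positivity
  have ht_lower : 1 / 3 ≤ t := by
    rw [ht, div_le_div_iff₀ (by norm_num) hpos]
    exact_mod_cast (by omega : 1 * (b + b') ≤ b * 3)
  have ht_upper : t ≤ 2 / 3 := by
    rw [ht, div_le_div_iff₀ hpos (by norm_num)]
    exact_mod_cast (by omega : b * 3 ≤ 2 * (b + b'))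
  have herror : ∀ s : ℝ, s ≤ 2 / 3 →
      (2 * Module.finrank ℝ E : ℝ) ≤ (1 - s) * (6 * Module.finrank ℝ E) := fun s hs => by
    nlinarith [(Module.finrank ℝ E).cast_nonneg (α := ℝ)]
  have hcompl : ∑ i ∈ A \ B, u i - (1 - t) • ∑ i ∈ A, u i =
      -(∑ i ∈ B, u i - t • ∑ i ∈ A, u i) := by
    rw [sum_sdiff_eq_sub hBA]
    module
  refine ⟨B, hBA, ⟨hB, ?_⟩, fun j => ?_, ?_⟩
  · exact seminorm_le_of_seminorm_sub_smul_le (by linarith) hsum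
      (hBp.trans (herror t ht_upper))
  · have hfiber : {i ∈ A \ B | c i = j} = {i ∈ A | c i = j} \ {i ∈ B | c i = j} := by grind
    rw [hfiber, card_sdiff_of_subset (filter_subset_filter _ hBA), hA, hB, Nat.add_sub_cancel_left]
  · refine seminorm_le_of_seminorm_sub_smul_le (t := 1 - t) (by linarith) hsum ?_
    rw [hcompl, map_neg_eq_map]
    exact hBp.trans (herror (1 - t) (by linarith))

/-- A family of `a` pairwise disjoint transversals of the colour classes of `A`: the `r`-th one
consists of the elements `f j r`, one for each colour `j`. When every class has `a` elements the
transversals partition `A`. -/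
structure IsTransversalListing (c : ι → κ) (A : Finset ι) {a : ℕ} (f : κ → Fin a → ι) : Prop where
  injective : ∀ j, Function.Injective (f j)
  mem : ∀ j r, f j r ∈ A
  color : ∀ j r, c (f j r) = j

theorem IsTransversalListing.append [DecidableEq ι] {c : ι → κ} {A B : Finset ι} (hBA : B ⊆ A)
    {a b : ℕ} {f : κ → Fin a → ι} {g : κ → Fin b → ι} (hf : IsTransversalListing c B f)
    (hg : IsTransversalListing c (A \ B) g) :
    IsTransversalListing c A fun j => Fin.append (f j) (g j) where
  injective j := Fin.append_injective_iff.mpr ⟨hf.injective j, hg.injective j,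
    fun x y h => (mem_sdiff.mp (hg.mem j y)).2 (h ▸ hf.mem j x)⟩
  mem j r := r.addCases (fun x => by simpa using hBA (hf.mem j x))
    fun x => by simpa using (mem_sdiff.mp (hg.mem j x)).1
  color j r := r.addCases (fun x => by simpa using hf.color j x)
    fun x => by simpa using hg.color j x

theorem exists_isTransversalListing_one [Fintype κ] [DecidableEq κ] {c : ι → κ} {A : Finset ι}
    (hA : ∀ j, #{i ∈ A | c i = j} = 1) (u : ι → E) :
    ∃ f : κ → Fin 1 → ι, IsTransversalListing c A f ∧ ∀ r, ∑ j, u (f j r) = ∑ i ∈ A, u i := by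
  choose g hg using fun j => card_eq_one.mp (hA j)
  have hgA : ∀ j, g j ∈ A ∧ c (g j) = j := fun j =>
    mem_filter.mp (hg j ▸ mem_singleton_self (g j))
  refine ⟨fun j _ => g j, ⟨fun j => Function.injective_of_subsingleton _, fun j _ => (hgA j).1,
    fun j _ => (hgA j).2⟩, fun _ => ?_⟩
  rw [← sum_fiberwise A c u]
  exact sum_congr rfl fun j _ => by rw [hg, sum_singleton]

theorem exists_isTransversalListing_seminorm_le [Finite ι] [Fintype κ] [DecidableEq κ]
    [Module ℝ E] [FiniteDimensional ℝ E] (p : Seminorm ℝ E) {u : ι → E} (hu : ∀ i, p (u i) ≤ 1)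
    {c : ι → κ} (a : ℕ) {A : Finset ι} (hA : ∀ j, #{i ∈ A | c i = j} = a)
    (hsum : p (∑ i ∈ A, u i) ≤ 6 * Module.finrank ℝ E) :
    ∃ f : κ → Fin a → ι, IsTransversalListing c A f ∧
      ∀ r, p (∑ j, u (f j r)) ≤ 6 * Module.finrank ℝ E := by
  classical
  induction a using Nat.strong_induction_on generalizing A with
  | _ a ih =>
  obtain rfl | rfl | ha : a = 0 ∨ a = 1 ∨ 2 ≤ a := by omega
  · exact ⟨fun _ => Fin.elim0, ⟨fun _ r => r.elim0, fun _ r => r.elim0, fun _ r => r.elim0⟩,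
      fun r => r.elim0⟩
  · obtain ⟨f, hf, hfu⟩ := exists_isTransversalListing_one hA u
    exact ⟨f, hf, fun r => by rwa [hfu]⟩
  obtain ⟨b, b', rfl, hb, hbb', hb'b⟩ : ∃ b b', a = b + b' ∧ 0 < b ∧ b ≤ 2 * b' ∧ b' ≤ 2 * b :=
    ⟨a / 2, a - a / 2, by omega, by omega, by omega, by omega⟩
  obtain ⟨B, hBA, ⟨hB, hBsum⟩, hC, hCsum⟩ := exists_split_seminorm_sum_le p hu hb hbb' hb'b hA hsum
  obtain ⟨f, hf, hfp⟩ := ih b (by omega) hB hBsum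
  obtain ⟨g, hg, hgp⟩ := ih b' (by omega) hC hCsum
  exact ⟨_, hf.append hBA hg, fun r => r.addCases (fun x => by simpa using hfp x)
    fun x => by simpa using hgp x⟩

end Transversals

section ColorfulSteinitz

open Finset

variable {κ E : Type*} [Fintype κ] [AddCommGroup E] [Module ℝ E] [FiniteDimensional ℝ E] {m : ℕ}
  {u : κ → Fin m → E}

theorem exists_perm_seminorm_sum_le_card_mul_finrank (p : Seminorm ℝ E) (hu : ∀ j i, p (u j i) ≤ 1)
    (hsum : ∑ j, ∑ i, u j i = 0) :
    ∃ π : κ → Equiv.Perm (Fin m), ∀ k : Fin m,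
      p (∑ i ∈ Iic k, ∑ j, u j (π j i)) ≤ Fintype.card κ * Module.finrank ℝ E := by
  choose π hπ using fun j => exists_perm_seminorm_sum_sub_smul_le p (hu j)
  refine ⟨π, fun k => ?_⟩
  set t : ℝ := ((k + 1 - Module.finrank ℝ E : ℕ) : ℝ)
  have hdrift : ∑ j, t • (m : ℝ)⁻¹ • ∑ i, u j i = 0 := by
    simp only [← smul_sum, hsum, smul_zero]
  calc p (∑ i ∈ Iic k, ∑ j, u j (π j i))
      = p (∑ j, (∑ i ∈ Iic k, u j (π j i) - t • (m : ℝ)⁻¹ • ∑ i, u j i)) := by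
        rw [sum_sub_distrib, hdrift, sub_zero, sum_comm]
    _ ≤ ∑ j, p (∑ i ∈ Iic k, u j (π j i) - t • (m : ℝ)⁻¹ • ∑ i, u j i) :=
        le_sum_of_subadditive p (map_zero p).le (map_add_le_add p) _ _
    _ ≤ ∑ _j : κ, (Module.finrank ℝ E * 1 : ℝ) := sum_le_sum fun j _ => hπ j k
    _ = Fintype.card κ * Module.finrank ℝ E := by simp

theorem exists_perm_seminorm_transversal_sum_le (p : Seminorm ℝ E) (hu : ∀ j i, p (u j i) ≤ 1)
    (hsum : ∑ j, ∑ i, u j i = 0) :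
    ∃ σ : κ → Equiv.Perm (Fin m), ∀ r, p (∑ j, u j (σ j r)) ≤ 6 * Module.finrank ℝ E := by
  classical
  have hfiber : ∀ j, #{q : κ × Fin m | q.1 = j} = m := fun j => by
    have hproduct : ({q : κ × Fin m | q.1 = j} : Finset _) = {j} ×ˢ univ := by
      ext q
      simp only [mem_filter_univ, mem_product, mem_singleton, mem_univ, and_true]
    rw [hproduct, card_product, card_singleton, card_univ, Fintype.card_fin, one_mul]
  have htotal : ∑ q : κ × Fin m, u q.1 q.2 = 0 := by rwa [Fintype.sum_prod_type]
  obtain ⟨f, hf, hfp⟩ := exists_isTransversalListing_seminorm_le p (u := fun q => u q.1 q.2)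
    (fun q => hu q.1 q.2) m hfiber (by rw [htotal, map_zero]; positivity)
  have hinj : ∀ j, Function.Injective fun r => (f j r).2 := fun j r r' h =>
    hf.injective j (Prod.ext (by rw [hf.color, hf.color]) h)
  exact ⟨fun j => Equiv.ofBijective _ (Finite.injective_iff_bijective.mp (hinj j)),
    fun r => by simpa [hf.color] using hfp r⟩

theorem exists_perm_seminorm_sum_le_six_mul_finrank_sq (p : Seminorm ℝ E)
    (hu : ∀ j i, p (u j i) ≤ 1) (hsum : ∑ j, ∑ i, u j i = 0) :
    ∃ π : κ → Equiv.Perm (Fin m), ∀ k : Fin m,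
      p (∑ i ∈ Iic k, ∑ j, u j (π j i)) ≤ 6 * (Module.finrank ℝ E : ℝ) ^ 2 := by
  obtain ⟨σ, hσ⟩ := exists_perm_seminorm_transversal_sum_le p hu hsum
  obtain ⟨τ, hτ⟩ := exists_perm_seminorm_sum_sub_smul_le p hσ
  have hzero : ∑ r, ∑ j, u j (σ j r) = 0 := by
    rw [sum_comm, ← hsum]
    exact sum_congr rfl fun j _ => Equiv.sum_comp (σ j) (u j)
  refine ⟨fun j => τ.trans (σ j), fun k => ?_⟩
  calc p (∑ i ∈ Iic k, ∑ j, u j (σ j (τ i))) ≤ Module.finrank ℝ E * (6 * Module.finrank ℝ E) := by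
        simpa [hzero] using hτ k
    _ = 6 * (Module.finrank ℝ E : ℝ) ^ 2 := by ring

theorem theorem2_general (p : Seminorm ℝ E) (hu : ∀ j i, p (u j i) ≤ 1)
    (hsum : ∑ j, ∑ i, u j i = 0) :
    ∃ π : κ → Equiv.Perm (Fin m), ∀ k : Fin m,
      p (∑ i ∈ Iic k, ∑ j, u j (π j i)) ≤
        min ((Fintype.card κ : ℝ) * Module.finrank ℝ E) (6 * (Module.finrank ℝ E : ℝ) ^ 2) := by
  rcases le_total ((Fintype.card κ : ℝ) * Module.finrank ℝ E)
    (6 * (Module.finrank ℝ E : ℝ) ^ 2) with hle | hle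
  · simpa only [min_eq_left hle] using exists_perm_seminorm_sum_le_card_mul_finrank p hu hsum
  · simpa only [min_eq_right hle] using exists_perm_seminorm_sum_le_six_mul_finrank_sq p hu hsum

theorem six_mul_sq_le_forty_mul_pow_five (d : ℕ) : 6 * (d : ℝ) ^ 2 ≤ 40 * (d : ℝ) ^ 5 := by
  rcases d.eq_zero_or_pos with rfl | hd
  · simp
  · have hd1 : (1 : ℝ) ≤ d := by exact_mod_cast hd
    gcongr <;> norm_num

end ColorfulSteinitz

theorem theorem2 (d m n : ℕ)
    (p : Seminorm ℝ (Fin d → ℝ)) (hp : ∀ x : Fin d → ℝ, p x = 0 → x = 0)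
    (u : Fin n → Fin m → (Fin d → ℝ))
    (hu : ∀ j i, u j i ∈ p.closedBall 0 1)
    (hsum : ∑ j : Fin n, ∑ i : Fin m, u j i = 0) :
    ∃ π : Fin n → Equiv.Perm (Fin m), ∀ k : Fin m,
      p (∑ i ∈ Finset.Iic k, ∑ j : Fin n, u j (π j i)) ≤
        min ((n : ℝ) * (d : ℝ)) (40 * (d : ℝ) ^ 5) := by
  obtain ⟨π, hπ⟩ := theorem2_general p (fun j i => p.mem_closedBall_zero.mp (hu j i)) hsum
  exact ⟨π, fun k => (by simpa using hπ k : _ ≤ min _ _).trans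
    (min_le_min_left _ (six_mul_sq_le_forty_mul_pow_five d))⟩
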